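/- Let $\mathcal{C}$ be a modular tensor category over $\mathbb{C}$, i.e. a $\mathbb{C}$-linear abelian semisimple ribbon category (with product $\boxtimes$, braiding $\sigma$ and twist $\theta$) with finite-dimensional morphism spaces, simple unit object $1$ and finitely many isomorphism classes of simple objects (called labels), whose $s$-matrix $s_{ij}=\operatorname{tr}(\sigma_{V_jV_i}\sigma_{V_iV_j})$ is invertible, where $i,j$ run over the labels and $V_i$ is a simple object representing the label $i$. Suppose that $\mathcal{C}$ is pre-Clifford: it is equipped with an object $V^-$ and an isomorphism $\iota:V^-\boxtimes V^-\cong 1$ such that $\theta_{V^-}=-1$. A label represented by a simple object $M$ is called NS if the double braiding $\zeta_M$ of $V^-$ and $M$ is $1$, and R if $\zeta_M=-1$. The functor $V^-\boxtimes ?$ induces an involution of the set of labels. Let $R^0$ be the set of its fixed points, let $NS^+$ be any set of representatives of the two-element orbits consisting of NS labels, and let $R^+$ be any set of representatives of the two-element orbits consisting of R labels. Let $A$, $B$, $C$, $D$ be the blocks of the $s$-matrix with index sets (rows $\times$ columns) $NS^+\times NS^+$, $NS^+\times R^+$, $R^+\times R^+$, $NS^+\times R^0$, respectively. Then the matrices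 $A$ and $C$ are symmetric and non-singular, the matrix $\begin{pmatrix} B & D\end{pmatrix}$ is non-singular (in particular, square), $$B^TD=0,\qquad\text{and}\qquad |R^+|+|R^0|=|NS^+|.$$ -/

import Mathlib

open CategoryTheory MonoidalCategory

universe v u

noncomputable section

namespace ModularTensor

/-- A (compatible) twist, or balancing, on a rigid braided category: a natural automorphism `θ` of
the identity functor with `θ_{X ⊗ Y} = σ_{Y X} σ_{X Y} (θ_X ⊗ θ_Y)` and `θ_{X*} = (θ_X)*`.
A rigid braided category with a twist is a ribbon category. -/
class RibbonCategory (C : Type u) [Category.{v} C] [MonoidalCategory C] [BraidedCategory C]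
    [RigidCategory C] where
  twist : ∀ X : C, X ≅ X
  twist_naturality : ∀ {X Y : C} (f : X ⟶ Y), f ≫ (twist Y).hom = (twist X).hom ≫ f
  twist_tensor : ∀ X Y : C, (twist (X ⊗ Y)).hom =
    ((twist X).hom ⊗ₘ (twist Y).hom) ≫ (β_ X Y).hom ≫ (β_ Y X).hom
  twist_dual : ∀ X : C, (twist (Xᘁ)).hom = ((twist X).hom)ᘁ

/-- The twist `θ_X`. -/
abbrev twist {C : Type u} [Category.{v} C] [MonoidalCategory C] [BraidedCategory C]
    [RigidCategory C] [RibbonCategory C] (X : C) : X ≅ X :=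
  RibbonCategory.twist X

/-- The quantum (ribbon) trace of an endomorphism, as an endomorphism of the unit object:
`1 ⟶ X ⊗ X* ⟶ X ⊗ X* ⟶ X* ⊗ X ⟶ 1`, where the middle maps are `θ_X f ⊗ id` and the braiding. -/
def ribbonTrace {C : Type u} [Category.{v} C] [MonoidalCategory C] [BraidedCategory C]
    [RigidCategory C] [RibbonCategory C] {X : C} (f : X ⟶ X) : 𝟙_ C ⟶ 𝟙_ C :=
  η_ X (Xᘁ) ≫ ((f ≫ (twist X).hom) ▷ (Xᘁ)) ≫ (β_ X (Xᘁ)).hom ≫ ε_ X (Xᘁ)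

/-- The double braiding `X ⊗ Y ⟶ Y ⊗ X ⟶ X ⊗ Y`. -/
def doubleBraiding {C : Type u} [Category.{v} C] [MonoidalCategory C] [BraidedCategory C]
    (X Y : C) : X ⊗ Y ⟶ X ⊗ Y :=
  (β_ X Y).hom ≫ (β_ Y X).hom

/-- The simple (irreducible) objects of `C`, up to isomorphism, are the labels. -/
instance simpleSetoid (C : Type u) [Category.{v} C] [Abelian C] :
    Setoid {X : C // Simple X} where
  r X Y := Nonempty (X.1 ≅ Y.1)
  iseqv := ⟨fun X => ⟨Iso.refl X.1⟩, fun ⟨e⟩ => ⟨e.symm⟩, fun ⟨e⟩ ⟨f⟩ => ⟨e.trans f⟩⟩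

/-- Labels: isomorphism classes of simple objects. -/
def Label (C : Type u) [Category.{v} C] [Abelian C] : Type u :=
  Quotient (simpleSetoid C)

/-- A chosen simple object `V_i` representing the label `i`. -/
def Label.obj {C : Type u} [Category.{v} C] [Abelian C] (i : Label C) : C :=
  (Quotient.out i).1

instance Label.simple_obj {C : Type u} [Category.{v} C] [Abelian C] (i : Label C) :
    Simple i.obj :=
  (Quotient.out i).2

/-- The label of a simple object. -/
def Label.mk {C : Type u} [Category.{v} C] [Abelian C] (X : C) (hX : Simple X) : Label C :=
  Quotient.mk (simpleSetoid C) ⟨X, hX⟩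

/-- Semisimplicity and finiteness for a `ℂ`-linear abelian tensor category: Hom spaces are finite
dimensional, the unit is simple, every object is a finite direct sum of simple objects, and there
are finitely many isomorphism classes of simple objects. -/
class IsFusion (C : Type u) [Category.{v} C] [Abelian C] [Linear ℂ C] [MonoidalCategory C] :
    Prop where
  finiteDimensional_hom : ∀ X Y : C, FiniteDimensional ℂ (X ⟶ Y)
  simple_unit : Simple (𝟙_ C)
  semisimple : ∀ X : C, ∃ (n : ℕ) (S : Fin n → C),
    (∀ k, Simple (S k)) ∧
      haveI : Limits.HasFiniteBiproducts C := Abelian.hasFiniteBiproducts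
      Nonempty (X ≅ Limits.biproduct S)
  finite_label : Finite (Label C)

instance Label.fintype (C : Type u) [Category.{v} C] [Abelian C] [Linear ℂ C]
    [MonoidalCategory C] [IsFusion C] : Fintype (Label C) :=
  haveI : Finite (Label C) := IsFusion.finite_label
  Fintype.ofFinite (Label C)

instance Label.decidableEq (C : Type u) [Category.{v} C] [Abelian C] : DecidableEq (Label C) :=
  Classical.decEq (Label C)

theorem exists_unitScalar {C : Type u} [Category.{v} C] [Abelian C] [Linear ℂ C]
    [MonoidalCategory C] [IsFusion C] (f : 𝟙_ C ⟶ 𝟙_ C) : ∃ c : ℂ, c • 𝟙 (𝟙_ C) = f := by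
  have : Simple (𝟙_ C) := IsFusion.simple_unit
  have : FiniteDimensional ℂ (𝟙_ C ⟶ 𝟙_ C) := IsFusion.finiteDimensional_hom _ _
  exact endomorphism_simple_eq_smul_id ℂ f

/-- The complex number corresponding to an endomorphism of the (simple) unit object. -/
def unitScalar {C : Type u} [Category.{v} C] [Abelian C] [Linear ℂ C]
    [MonoidalCategory C] [IsFusion C] (f : 𝟙_ C ⟶ 𝟙_ C) : ℂ :=
  (exists_unitScalar f).choose

/-- The `s`-matrix: `s_{ij}` is the trace of the double braiding on `V_i ⊗ V_j`. -/
def sMatrix (C : Type u) [Category.{v} C] [Abelian C] [Linear ℂ C] [MonoidalCategory C]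
    [BraidedCategory C] [RigidCategory C] [RibbonCategory C] [IsFusion C] :
    Matrix (Label C) (Label C) ℂ :=
  Matrix.of fun i j => unitScalar (ribbonTrace (doubleBraiding i.obj j.obj))

/-- A modular tensor category over `ℂ`: a semisimple ribbon category with finitely many simple
objects up to isomorphism and with invertible `s`-matrix. -/
class IsModularTensorCategory (C : Type u) [Category.{v} C] [Abelian C] [Linear ℂ C]
    [MonoidalCategory C] [MonoidalPreadditive C] [MonoidalLinear ℂ C]
    [BraidedCategory C] [RigidCategory C] [RibbonCategory C] : Prop extends IsFusion C where
  isUnit_sMatrix : IsUnit (sMatrix C)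

/-- The additional structure of a pre-Clifford modular tensor category: an object `V` (written
`V⁻` in mathematics) with an isomorphism `ι : V ⊗ V ≅ 1` and with `θ_V = -1`. -/
structure PreClifford (C : Type u) [Category.{v} C] [Abelian C] [MonoidalCategory C]
    [BraidedCategory C] [RigidCategory C] [RibbonCategory C] where
  V : C
  ι : V ⊗ V ≅ 𝟙_ C
  twist_V : (twist V).hom = -𝟙 V

namespace PreClifford

variable {C : Type u} [Category.{v} C] [Abelian C] [MonoidalCategory C]
    [BraidedCategory C] [RigidCategory C] [RibbonCategory C] (P : PreClifford C)

/-- `X ≅ V ⊗ (V ⊗ X)`, naturally in `X`. -/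
def tensorTwice : 𝟭 C ≅ tensorLeft P.V ⋙ tensorLeft P.V :=
  NatIso.ofComponents
    (fun X => (λ_ X).symm ≪≫ whiskerRightIso P.ι.symm X ≪≫ α_ P.V P.V X)
    (fun f => by
      dsimp
      simp only [whiskerRightIso_hom, Iso.symm_hom, Category.assoc]
      rw [leftUnitor_inv_naturality_assoc, whisker_exchange_assoc,
        ← associator_naturality_right])

/-- `V ⊗ ?` is an equivalence of categories. -/
def tensorEquivalence : C ≌ C :=
  CategoryTheory.Equivalence.mk (tensorLeft P.V) (tensorLeft P.V) P.tensorTwice P.tensorTwice.symm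

theorem simple_tensor (X : C) (hX : Simple X) : Simple (P.V ⊗ X) :=
  simple_obj P.tensorEquivalence.functor X

/-- The involution of labels induced by `V ⊗ ?`. -/
def bar (i : Label C) : Label C :=
  Label.mk (P.V ⊗ i.obj) (P.simple_tensor i.obj i.simple_obj)

/-- `ζ_M`, the double braiding of `V` and `M`. -/
def zeta (M : C) : P.V ⊗ M ⟶ P.V ⊗ M :=
  doubleBraiding P.V M

/-- Neveu-Schwarz labels: `ζ = 1`. -/
def IsNS (i : Label C) : Prop :=
  P.zeta i.obj = 𝟙 _

/-- Ramond labels: `ζ = -1`. -/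
def IsR (i : Label C) : Prop :=
  P.zeta i.obj = -𝟙 _

/-- `T` is a set of representatives of the regular (two-element) orbits of the involution `bar`
that consist of labels of the given type: the elements of `T` are such labels, and `T` contains
exactly one element of each such orbit `{i, bar i}`. -/
def IsRepresentatives (type : Label C → Prop) (T : Finset (Label C)) : Prop :=
  (∀ i ∈ T, type i ∧ P.bar i ≠ i) ∧
    ∀ i, type i → P.bar i ≠ i → ∃! j, j ∈ T ∧ (j = i ∨ j = P.bar i)

/-- The non-split Ramond labels `R⁰`: the fixed points of the involution. -/
def R0 [Linear ℂ C] [IsFusion C] : Finset (Label C) :=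
  Finset.univ.filter fun i => P.bar i = i

end PreClifford

/-- The block of the `s`-matrix with rows in `I` and columns in `J`. -/
def sBlock (C : Type u) [Category.{v} C] [Abelian C] [Linear ℂ C] [MonoidalCategory C]
    [BraidedCategory C] [RigidCategory C] [RibbonCategory C] [IsFusion C]
    (I J : Finset (Label C)) : Matrix I J ℂ :=
  (sMatrix C).submatrix (fun i => i.1) (fun j => j.1)

/-- A matrix, with rows and columns indexed by possibly different finite sets, is non-singular if
it has a two-sided inverse. -/
def NonSingular {m n : Type*} [Fintype m] [Fintype n] [DecidableEq m] [DecidableEq n]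
    (M : Matrix m n ℂ) : Prop :=
  ∃ N : Matrix n m ℂ, M * N = 1 ∧ N * M = 1

end ModularTensor

end

/-!
Encircling a simple object `Z` by a loop coloured by `X` multiplies `Z` by a scalar (Schur's lemma),
and parallel loops multiply these scalars. With `hopfLink` for the invariant of the Hopf link and
`qdim` for the quantum dimension this gives
`hopfLink Z (X ⊗ Y) * qdim Z = hopfLink Z X * hopfLink Z Y` (`hopfLink_tensor`). It rests on the
multiplicativity of the quantum trace: the cap `X ⊗ X* ⟶ 1` built from twist and braiding is
monoidal (`cap_tensor`), so a trace over a tensor product is an iterated partial trace.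

For `X = V` the loop acts on the simple object `j` as `d * ζ j`, where `ζ j = ±1` is the double
braiding of `V` with `j` and `d = ±1` is the dimension of `V`. Hence
`s (bar i) j = d * ζ j * s i j` (`PreClifford.sMatrix_bar_apply`). Comparing the twists of `V ⊗ X`
and `X` shows that fixed points of the involution are Ramond labels, and the column of the unit
object shows that `d = 1` as soon as there is a fixed point. In a basis of sums and differences over
the orbits, the `s`-matrix is therefore block diagonal with blocks `A`, `E` and
`(0 M; Mᵀ 0)`, where `M = (B D)`, up to scalars. Each block inherits injectivity from the
`s`-matrix; for `M` this applies to the transpose as well, so `M` is invertible and square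
(`IsGradedInvolution.injective_even`, `injective_odd`, `injective_mixed` and
`injective_mixed_transpose`).

The relation `Bᵀ * D = 0` says that a split Ramond column is orthogonal to a non-split one. Indeed
any two columns `j`, `k` of the `s`-matrix with `Hom(j ⊗ k, 1) = 0` are orthogonal
(`sum_sMatrix_mul_sMatrix_eq_zero`): `∑ i, s i j * s i k` is `∑ i, qdim i * hopfLink i (j ⊗ k)`,
and `∑ i, qdim i * s i m = 0` unless `m` is the unit (`sum_qdim_mul_hopfLink_eq_zero`). The latter
follows from `hopfLink_mul_sum_qdim`, by which a nonzero sum makes row `m` proportional to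
the row of the unit.
-/

noncomputable section

namespace ModularTensor

/-! ### Braidings, caps and the quantum trace -/

section Trace
open ExactPairing BraidedCategory

variable {C : Type u} [Category.{v} C] [MonoidalCategory C] [BraidedCategory C]

/-- A strand `Y` that crosses one leg of a cap can be slid over the cap, so that it crosses the
other leg with the inverse braiding. -/
theorem whiskerLeft_braiding_comp_cap {X X' : C} (Y : C) (c : X ⊗ X' ⟶ 𝟙_ C) :
    X ◁ (β_ Y X').hom ≫ (α_ X X' Y).inv ≫ c ▷ Y =
      (α_ X Y X').inv ≫ (β_ Y X).inv ▷ X' ≫ (α_ Y X X').hom ≫ Y ◁ c ≫ (ρ_ Y).hom ≫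
        (λ_ Y).inv := by
  have h := braiding_naturality_right Y c
  rw [braiding_tensorUnit_right] at h
  rw [h, braiding_tensor_right_hom]
  simp

theorem braiding_comp_evaluation (X X' Y : C) [ExactPairing X X'] :
    (β_ (X ⊗ Y) X').hom ≫ (α_ X' X Y).inv ≫ ε_ X X' ▷ Y =
      (β_ Y X).inv ▷ X' ≫ (α_ Y X X').hom ≫ Y ◁ ((β_ X X').hom ≫ ε_ X X') ≫ (ρ_ Y).hom ≫
        (λ_ Y).inv := by
  have h := whiskerLeft_braiding_comp_cap Y ((β_ X X').hom ≫ ε_ X X')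
  rw [braiding_tensor_left_hom]
  simp only [Category.assoc, Iso.hom_inv_id_assoc, comp_whiskerRight] at h ⊢
  rw [h]
  simp

/-- The two caps obtained by braiding the nested evaluation of `X ⊗ Y` can be separated at the cost
of an inverse full twist of `X` around `Y`. -/
theorem braiding_comp_evaluation_tensor (X X' Y Y' : C) [ExactPairing X X'] [ExactPairing Y Y'] :
    (β_ (X ⊗ Y) (Y' ⊗ X')).hom ≫ ε_ (X ⊗ Y) (Y' ⊗ X') =
      ((β_ Y X).inv ≫ (β_ X Y).inv) ▷ (Y' ⊗ X') ⊗≫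
        X ◁ ((β_ Y Y').hom ≫ ε_ Y Y') ▷ X' ⊗≫ (β_ X X').hom ≫ ε_ X X' := by
  calc
    _ = 𝟙 _ ⊗≫ (β_ (X ⊗ Y) Y').hom ▷ X' ⊗≫
          Y' ◁ ((β_ (X ⊗ Y) X').hom ≫ (α_ X' X Y).inv ≫ ε_ X X' ▷ Y) ⊗≫ ε_ Y Y' := by
      rw [tensor_evaluation, braiding_tensor_right_hom]
      monoidal
    _ = 𝟙 _ ⊗≫ ((β_ (X ⊗ Y) Y').hom ≫ Y' ◁ (β_ Y X).inv) ▷ X' ⊗≫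
          ((Y' ⊗ Y) ◁ ((β_ X X').hom ≫ ε_ X X') ≫ ε_ Y Y' ▷ 𝟙_ C) ⊗≫ 𝟙 _ := by
      rw [braiding_comp_evaluation]
      monoidal
    _ = (β_ Y X).inv ▷ (Y' ⊗ X') ⊗≫
          ((β_ (Y ⊗ X) Y').hom ≫ (α_ Y' Y X).inv ≫ ε_ Y Y' ▷ X) ▷ X' ⊗≫
            (β_ X X').hom ≫ ε_ X X' := by
      rw [whisker_exchange, ← braiding_naturality_left]
      monoidal
    _ = _ := by
      rw [braiding_comp_evaluation]
      monoidal

theorem doubleBraiding_naturality {X X₁ Y Y₁ : C} (f : X ⟶ X₁) (g : Y ⟶ Y₁) :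
    (f ⊗ₘ g) ≫ doubleBraiding X₁ Y₁ = doubleBraiding X Y ≫ (f ⊗ₘ g) := by
  simp [doubleBraiding]

theorem doubleBraiding_tensor_right (X Y Z : C) :
    doubleBraiding X (Y ⊗ Z) = (α_ X Y Z).inv ≫ (β_ X Y).hom ▷ Z ≫ (α_ Y X Z).hom ≫
      Y ◁ doubleBraiding X Z ≫ (α_ Y X Z).inv ≫ (β_ Y X).hom ▷ Z ≫ (α_ X Y Z).hom := by
  simp [doubleBraiding, braiding_tensor_right_hom, braiding_tensor_left_hom]

theorem doubleBraiding_unit_left (X : C) : doubleBraiding (𝟙_ C) X = 𝟙 _ := by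
  simp [doubleBraiding, braiding_tensorUnit_left, braiding_tensorUnit_right]

variable [RigidCategory C] [RibbonCategory C]

/-- The evaluation `X ⊗ X' ⟶ 1` of the opposite handedness, built from the braiding and the
twist; here `X'` is any right dual of `X`. -/
def cap (X X' : C) [ExactPairing X X'] : X ⊗ X' ⟶ 𝟙_ C :=
  (twist X).hom ▷ X' ≫ (β_ X X').hom ≫ ε_ X X'

/-- Monoidality of the cap: the full twist in `θ_{X ⊗ Y}` cancels the inverse full twist that
arises from separating the two caps. -/
theorem cap_tensor (X X' Y Y' : C) [ExactPairing X X'] [ExactPairing Y Y'] :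
    cap (X ⊗ Y) (Y' ⊗ X') = 𝟙 _ ⊗≫ X ◁ cap Y Y' ▷ X' ⊗≫ cap X X' := by
  calc
    _ = (((twist X).hom ⊗ₘ (twist Y).hom) ≫
          ((β_ X Y).hom ≫ (β_ Y X).hom) ≫ (β_ Y X).inv ≫ (β_ X Y).inv) ▷ (Y' ⊗ X') ⊗≫
        X ◁ ((β_ Y Y').hom ≫ ε_ Y Y') ▷ X' ⊗≫ (β_ X X').hom ≫ ε_ X X' := by
      rw [cap, RibbonCategory.twist_tensor, braiding_comp_evaluation_tensor]
      monoidal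
    _ = ((twist X).hom ⊗ₘ (twist Y).hom) ▷ (Y' ⊗ X') ⊗≫
        X ◁ ((β_ Y Y').hom ≫ ε_ Y Y') ▷ X' ⊗≫ (β_ X X').hom ≫ ε_ X X' := by
      simp
    _ = 𝟙 _ ⊗≫ ((twist X).hom ▷ ((Y ⊗ Y') ⊗ X') ≫
          X ◁ (((twist Y).hom ▷ Y' ≫ (β_ Y Y').hom ≫ ε_ Y Y') ▷ X')) ⊗≫
            (β_ X X').hom ≫ ε_ X X' := by
      rw [MonoidalCategory.tensorHom_def]
      monoidal
    _ = _ := by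
      rw [← whisker_exchange]
      simp only [cap]
      monoidal

/-- The partial trace of `h : Y ⊗ X ⟶ Z ⊗ X` over the factor `X`, computed with any right dual
`X'` of `X`. -/
def partialTrace (X X' : C) [ExactPairing X X'] {Y Z : C} (h : Y ⊗ X ⟶ Z ⊗ X) : Y ⟶ Z :=
  (ρ_ Y).inv ≫ Y ◁ η_ X X' ≫ (α_ Y X X').inv ≫ h ▷ X' ≫ (α_ Z X X').hom ≫ Z ◁ cap X X' ≫
    (ρ_ Z).hom

theorem partialTrace_naturality (X X' : C) [ExactPairing X X'] {Y Y₁ Z Z₁ : C} (f : Y₁ ⟶ Y)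
    (h : Y ⊗ X ⟶ Z ⊗ X) (g : Z ⟶ Z₁) :
    partialTrace X X' (f ▷ X ≫ h ≫ g ▷ X) = f ≫ partialTrace X X' h ≫ g := by
  calc
    _ = (ρ_ _).inv ≫ (Y₁ ◁ η_ X X' ≫ f ▷ (X ⊗ X')) ≫ (α_ Y X X').inv ≫ h ▷ X' ≫
          (α_ Z X X').hom ≫ (g ▷ (X ⊗ X') ≫ Z₁ ◁ cap X X') ≫ (ρ_ Z₁).hom := by
      rw [partialTrace]
      monoidal
    _ = _ := by
      rw [whisker_exchange, ← whisker_exchange g, partialTrace]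
      monoidal

theorem partialTrace_whiskerLeft (X X' A : C) [ExactPairing X X'] {Y Z : C}
    (h : Y ⊗ X ⟶ Z ⊗ X) :
    partialTrace X X' ((α_ A Y X).hom ≫ A ◁ h ≫ (α_ A Z X).inv) = A ◁ partialTrace X X' h := by
  simp only [partialTrace]
  monoidal

theorem partialTrace_tensor (X X' Y Y' : C) [ExactPairing X X'] [ExactPairing Y Y'] {Z W : C}
    (h : Z ⊗ (X ⊗ Y) ⟶ W ⊗ (X ⊗ Y)) :
    partialTrace (X ⊗ Y) (Y' ⊗ X') h =
      partialTrace X X' (partialTrace Y Y' ((α_ Z X Y).hom ≫ h ≫ (α_ W X Y).inv)) := by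
  simp only [partialTrace, tensor_coevaluation, cap_tensor]
  monoidal

/-- The quantum trace computed with an arbitrary right dual `X'` of `X`. -/
def pairingTrace (X X' : C) [ExactPairing X X'] (f : X ⟶ X) : 𝟙_ C ⟶ 𝟙_ C :=
  η_ X X' ≫ f ▷ X' ≫ cap X X'

theorem ribbonTrace_eq_pairingTrace {X : C} (f : X ⟶ X) :
    ribbonTrace f = pairingTrace X Xᘁ f := by
  simp [ribbonTrace, pairingTrace, cap]

/-- The trace is cyclic, whichever duals are used to compute it. -/
theorem pairingTrace_comp_comm (X X' Y Y' : C) [p : ExactPairing X X'] [q : ExactPairing Y Y']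
    (f : X ⟶ Y) (g : Y ⟶ X) :
    pairingTrace X X' (f ≫ g) = pairingTrace Y Y' (g ≫ f) := by
  let iX : HasRightDual X := ⟨X'⟩
  let iY : HasRightDual Y := ⟨Y'⟩
  let f' : Y' ⟶ X' := @rightAdjointMate C _ _ X Y iX iY f
  have h1 : η_ Y Y' ≫ Y ◁ f' = η_ X X' ≫ f ▷ X' :=
    @coevaluation_comp_rightAdjointMate C _ _ X Y iX iY f
  have h2 : f' ▷ X ≫ ε_ X X' = Y' ◁ f ≫ ε_ Y Y' :=
    @rightAdjointMate_comp_evaluation C _ _ X Y iX iY f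
  calc
    _ = (η_ X X' ≫ f ▷ X') ≫ g ▷ X' ≫ cap X X' := by simp [pairingTrace]
    _ = η_ Y Y' ≫ g ▷ Y' ≫ (twist X).hom ▷ Y' ≫ (X ◁ f' ≫ (β_ X X').hom) ≫ ε_ X X' := by
      rw [← h1, cap]
      simp only [Category.assoc]
      rw [whisker_exchange_assoc, whisker_exchange_assoc]
    _ = η_ Y Y' ≫ g ▷ Y' ≫ ((twist X).hom ≫ f) ▷ Y' ≫ (β_ Y Y').hom ≫ ε_ Y Y' := by
      rw [braiding_naturality_right, Category.assoc, h2, ← braiding_naturality_left_assoc]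
      simp
    _ = _ := by
      rw [← RibbonCategory.twist_naturality, pairingTrace, cap]
      simp

theorem ribbonTrace_comp_comm {X Y : C} (f : X ⟶ Y) (g : Y ⟶ X) :
    ribbonTrace (f ≫ g) = ribbonTrace (g ≫ f) := by
  simpa only [ribbonTrace_eq_pairingTrace] using pairingTrace_comp_comm X Xᘁ Y Yᘁ f g

theorem ribbonTrace_conj {X Y : C} (e : X ≅ Y) (f : Y ⟶ Y) :
    ribbonTrace (e.hom ≫ f ≫ e.inv) = ribbonTrace f := by
  rw [ribbonTrace_comp_comm]
  simp

theorem ribbonTrace_eq_pairingTrace_of_exactPairing {X : C} (X' : C) [ExactPairing X X']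
    (f : X ⟶ X) : ribbonTrace f = pairingTrace X X' f := by
  simpa [ribbonTrace_eq_pairingTrace] using pairingTrace_comp_comm X Xᘁ X X' f (𝟙 X)

theorem pairingTrace_eq_partialTrace (X X' : C) [ExactPairing X X'] (f : X ⟶ X) :
    pairingTrace X X' f = partialTrace X X' (𝟙_ C ◁ f) := by
  simp only [partialTrace, pairingTrace]
  monoidal

/-- The trace over `Z ⊗ X` can be taken over `X` and then over `Z`. -/
theorem ribbonTrace_partialTrace (X X' : C) [ExactPairing X X'] {Z : C} (f : Z ⊗ X ⟶ Z ⊗ X) :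
    ribbonTrace (partialTrace X X' f) = ribbonTrace f := by
  rw [ribbonTrace_eq_pairingTrace_of_exactPairing (X := Z ⊗ X) (X' ⊗ Zᘁ),
    pairingTrace_eq_partialTrace, partialTrace_tensor, partialTrace_whiskerLeft,
    ← pairingTrace_eq_partialTrace, ribbonTrace_eq_pairingTrace]

/-- The quantum trace of an endomorphism of the dual of `X` computed on `X`: the dimensions of
`X` and of its dual agree. -/
theorem ribbonTrace_id_rightDual (X : C) : ribbonTrace (𝟙 (Xᘁ)) = ribbonTrace (𝟙 X) := by
  let _ : ExactPairing Xᘁ X := exactPairing_swap X Xᘁ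
  rw [ribbonTrace_eq_pairingTrace_of_exactPairing X]
  have h1 : η_ Xᘁ X = η_ X Xᘁ ≫ (β_ Xᘁ X).inv := rfl
  have h2 : ε_ Xᘁ X = (β_ X Xᘁ).hom ≫ ε_ X Xᘁ := rfl
  have h3 : η_ X Xᘁ ≫ X ◁ ((twist X).hom)ᘁ = η_ X Xᘁ ≫ (twist X).hom ▷ Xᘁ :=
    coevaluation_comp_rightAdjointMate _
  calc
    _ = η_ X Xᘁ ≫ (β_ Xᘁ X).inv ≫ ((twist Xᘁ).hom ▷ X ≫ (β_ Xᘁ X).hom) ≫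
          (β_ X Xᘁ).hom ≫ ε_ X Xᘁ := by
      simp [pairingTrace, cap, h1, h2]
    _ = (η_ X Xᘁ ≫ X ◁ ((twist X).hom)ᘁ) ≫ (β_ X Xᘁ).hom ≫ ε_ X Xᘁ := by
      rw [braiding_naturality_left, ← RibbonCategory.twist_dual]
      simp
    _ = _ := by
      rw [h3]
      simp [ribbonTrace]

/-- The endomorphism of `Z` given by a loop coloured by `X` around a strand coloured by `Z`. -/
def encircle (X Z : C) : Z ⟶ Z :=
  partialTrace X Xᘁ (doubleBraiding Z X)

theorem ribbonTrace_encircle (X Z : C) :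
    ribbonTrace (encircle X Z) = ribbonTrace (doubleBraiding Z X) :=
  ribbonTrace_partialTrace X Xᘁ _

theorem ribbonTrace_doubleBraiding_comm (X Y : C) :
    ribbonTrace (doubleBraiding X Y) = ribbonTrace (doubleBraiding Y X) :=
  ribbonTrace_comp_comm _ _

/-- Two parallel loops around `Z`, coloured by `X` and `Y`: the inner one is evaluated first. -/
theorem partialTrace_doubleBraiding_tensor (X Y Z : C) :
    partialTrace (X ⊗ Y) (Yᘁ ⊗ Xᘁ) (doubleBraiding Z (X ⊗ Y)) =
      partialTrace X Xᘁ ((β_ Z X).hom ≫ X ◁ encircle Y Z ≫ (β_ X Z).hom) := by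
  rw [partialTrace_tensor, encircle, ← partialTrace_whiskerLeft, ← partialTrace_naturality,
    doubleBraiding_tensor_right]
  simp

theorem twist_unit : (twist (𝟙_ C)).hom = 𝟙 (𝟙_ C) := by
  have h1 := RibbonCategory.twist_tensor (𝟙_ C) (𝟙_ C)
  have h2 := RibbonCategory.twist_naturality (λ_ (𝟙_ C)).hom
  -- The twist of the unit is an invertible idempotent.
  have h3 : (twist (𝟙_ C)).hom ≫ (twist (𝟙_ C)).hom = (twist (𝟙_ C)).hom := by
    rw [← cancel_epi (λ_ (𝟙_ C)).hom]
    rw [h2, h1]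
    simp [MonoidalCategory.tensorHom_def, unitors_equal, unitors_inv_equal]
  rwa [← cancel_mono (twist (𝟙_ C)).hom, Category.id_comp]

theorem ribbonTrace_id_unit : ribbonTrace (𝟙 (𝟙_ C)) = 𝟙 (𝟙_ C) := by
  rw [ribbonTrace_eq_pairingTrace_of_exactPairing (𝟙_ C)]
  have h1 : η_ (𝟙_ C) (𝟙_ C) = (ρ_ (𝟙_ C)).inv := rfl
  have h2 : ε_ (𝟙_ C) (𝟙_ C) = (ρ_ (𝟙_ C)).hom := rfl
  simp [pairingTrace, cap, h1, h2, twist_unit, unitors_inv_equal]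

end Trace

/-! ### Labels, multiplicities and additive invariants -/

section Labels

variable {C : Type u} [Category.{v} C] [Abelian C]

theorem Label.mk_obj (i : Label C) : Label.mk i.obj i.simple_obj = i :=
  Quotient.out_eq i

theorem Label.mk_eq_iff {X Y : C} (hX : Simple X) (hY : Simple Y) :
    Label.mk X hX = Label.mk Y hY ↔ Nonempty (X ≅ Y) :=
  Quotient.eq (r := simpleSetoid C)

theorem Label.nonempty_obj_iso {X : C} (hX : Simple X) : Nonempty ((Label.mk X hX).obj ≅ X) := by
  rw [← Label.mk_eq_iff (Label.simple_obj _) hX, Label.mk_obj]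

theorem Label.obj_iso_iff {i j : Label C} : Nonempty (i.obj ≅ j.obj) ↔ i = j := by
  rw [← Label.mk_eq_iff i.simple_obj j.simple_obj, Label.mk_obj, Label.mk_obj]

end Labels

section Decomposition

open Limits Module

variable {C : Type u} [Category.{v} C] [Abelian C] [Linear ℂ C]

/-- A complex-valued function on objects that is invariant under isomorphism and additive on finite
direct sums. -/
structure IsAdditiveInvariant (φ : C → ℂ) : Prop where
  congr : ∀ {X Y : C}, (X ≅ Y) → φ X = φ Y
  map_sum : ∀ {n : ℕ} {S : Fin n → C} (b : Bicone S), ∑ k, b.π k ≫ b.ι k = 𝟙 b.pt →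
    φ b.pt = ∑ k, φ (S k)

theorem finrank_hom_congr {X X₁ Y Y₁ : C} (e : X ≅ X₁)
    (f : Y ≅ Y₁) :
    finrank ℂ (X ⟶ Y) = finrank ℂ (X₁ ⟶ Y₁) :=
  (Linear.homCongr ℂ e f).finrank_eq

variable [MonoidalCategory C]

section

variable [MonoidalPreadditive C] [MonoidalLinear ℂ C]

theorem finrank_tensorLeft_hom (X Y Y' Z : C) [ExactPairing Y Y'] :
    finrank ℂ (Y' ⊗ X ⟶ Z) = finrank ℂ (X ⟶ Y ⊗ Z) :=
  LinearEquiv.finrank_eq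
    { tensorLeftHomEquiv X Y Y' Z with
      map_add' := fun f g => by simp [tensorLeftHomEquiv]
      map_smul' := fun c f => by simp [tensorLeftHomEquiv] }

theorem finrank_tensorRight_hom (X Y Y' Z : C) [ExactPairing Y Y'] :
    finrank ℂ (X ⊗ Y ⟶ Z) = finrank ℂ (X ⟶ Z ⊗ Y') :=
  LinearEquiv.finrank_eq
    { tensorRightHomEquiv X Y Y' Z with
      map_add' := fun f g => by simp [tensorRightHomEquiv]
      map_smul' := fun c f => by simp [tensorRightHomEquiv] }

end

variable [IsFusion C]

instance finiteDimensional_hom (X Y : C) : FiniteDimensional ℂ (X ⟶ Y) :=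
  IsFusion.finiteDimensional_hom X Y

instance simple_unit : Simple (𝟙_ C) :=
  IsFusion.simple_unit

theorem isAdditiveInvariant_finrank_hom_to (D : C) :
    IsAdditiveInvariant fun X : C => (finrank ℂ (X ⟶ D) : ℂ) where
  congr e := by
    congr 1
    exact (Linear.homCongr ℂ e (Iso.refl D)).finrank_eq
  map_sum {n S} b hb := by
    let e : (b.pt ⟶ D) ≃ₗ[ℂ] ((k : Fin n) → (S k ⟶ D)) :=
      { toFun := fun f k => b.ι k ≫ f
        invFun := fun g => ∑ k, b.π k ≫ g k
        map_add' := fun f g => by ext k; simp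
        map_smul' := fun c f => by ext k; simp
        left_inv := fun f => by
          simp only [← Category.assoc]
          rw [← Preadditive.sum_comp, hb, Category.id_comp]
        right_inv := fun g => by
          ext k
          dsimp only
          rw [Preadditive.comp_sum, Finset.sum_eq_single k]
          · simp
          · intro l _ hl
            rw [← Category.assoc, bicone_ι_π_ne _ hl.symm, zero_comp]
          · simp }
    rw [e.finrank_eq, finrank_pi_fintype]
    simp

theorem isAdditiveInvariant_finrank_hom_from (D : C) :
    IsAdditiveInvariant fun X : C => (finrank ℂ (D ⟶ X) : ℂ) where
  congr e := by
    congr 1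
    exact (Linear.homCongr ℂ (Iso.refl D) e).finrank_eq
  map_sum {n S} b hb := by
    let e : (D ⟶ b.pt) ≃ₗ[ℂ] ((k : Fin n) → (D ⟶ S k)) :=
      { toFun := fun f k => f ≫ b.π k
        invFun := fun g => ∑ k, g k ≫ b.ι k
        map_add' := fun f g => by ext k; simp
        map_smul' := fun c f => by ext k; simp
        left_inv := fun f => by
          simp only [Category.assoc]
          rw [← Preadditive.comp_sum, hb, Category.comp_id]
        right_inv := fun g => by
          ext k
          dsimp only
          rw [Preadditive.sum_comp, Finset.sum_eq_single k]
          · simp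
          · intro l _ hl
            rw [Category.assoc, bicone_ι_π_ne _ hl, comp_zero]
          · simp }
    rw [e.finrank_eq, finrank_pi_fintype]
    simp

theorem finrank_hom_simple_label {X : C} (hX : Simple X) (m : Label C) :
    (finrank ℂ (X ⟶ m.obj) : ℂ) = if Label.mk X hX = m then 1 else 0 := by
  split_ifs with h
  · rw [← Label.mk_obj m, Label.mk_eq_iff] at h
    rw [(finrank_hom_simple_simple_eq_one_iff ℂ X m.obj).2 h, Nat.cast_one]
  · rw [← Label.mk_obj m, Label.mk_eq_iff] at h
    rw [(finrank_hom_simple_simple_eq_zero_iff ℂ X m.obj).2 (not_nonempty_iff.1 h), Nat.cast_zero]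

/-- An additive invariant is determined by its values on simple objects, by means of the
multiplicities of the simple objects. -/
theorem IsAdditiveInvariant.eq_sum {φ : C → ℂ} (hφ : IsAdditiveInvariant φ) (X : C) :
    φ X = ∑ m : Label C, (finrank ℂ (X ⟶ m.obj) : ℂ) * φ m.obj := by
  have : HasFiniteBiproducts C := Abelian.hasFiniteBiproducts
  obtain ⟨n, S, hS, ⟨e⟩⟩ := IsFusion.semisimple X
  have hb : ∑ k, (biproduct.bicone S).π k ≫ (biproduct.bicone S).ι k =
      𝟙 (biproduct.bicone S).pt := biproduct.total
  have key : ∀ {ψ : C → ℂ}, IsAdditiveInvariant ψ → ψ X = ∑ k, ψ (S k) := fun hψ =>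
    (hψ.congr e).trans (hψ.map_sum _ hb)
  simp_rw [key (isAdditiveInvariant_finrank_hom_to _), finrank_hom_simple_label (hS _),
    Finset.sum_mul]
  rw [key hφ, Finset.sum_comm]
  refine Finset.sum_congr rfl fun k _ => ?_
  simp only [ite_mul, one_mul, zero_mul, Finset.sum_ite_eq, Finset.mem_univ, if_true]
  exact hφ.congr (Label.nonempty_obj_iso (hS k)).some.symm

theorem finrank_hom_label_label (i m : Label C) :
    (finrank ℂ (i.obj ⟶ m.obj) : ℂ) = if i = m then 1 else 0 := by
  rw [finrank_hom_simple_label i.simple_obj, Label.mk_obj]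

/-- In a semisimple category the multiplicity of a simple object can be read off from the morphisms
into it or out of it. -/
theorem finrank_hom_from_label (X : C) (m : Label C) :
    (finrank ℂ (m.obj ⟶ X) : ℂ) = finrank ℂ (X ⟶ m.obj) := by
  rw [(isAdditiveInvariant_finrank_hom_from m.obj).eq_sum X]
  simp [finrank_hom_label_label]

/-- An object whose endomorphisms are scalars receives nonzero morphisms from at most one simple
object. -/
theorem eq_of_finrank_hom_ne_zero {D : C} (hD : finrank ℂ (D ⟶ D) = 1) {i j : Label C}
    (hi : finrank ℂ (i.obj ⟶ D) ≠ 0) (hj : finrank ℂ (j.obj ⟶ D) ≠ 0) : i = j := by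
  by_contra hij
  have h := (isAdditiveInvariant_finrank_hom_to D).eq_sum D
  simp only [finrank_hom_from_label, hD] at h
  norm_cast at h
  have hi' : finrank ℂ (D ⟶ i.obj) ≠ 0 := by
    have := finrank_hom_from_label D i
    norm_cast at this
    rwa [← this]
  have hj' : finrank ℂ (D ⟶ j.obj) ≠ 0 := by
    have := finrank_hom_from_label D j
    norm_cast at this
    rwa [← this]
  -- The dimension of the endomorphism space is the sum of the squared multiplicities.
  have h2 := Finset.sum_le_sum_of_subset (f := fun m : Label C =>
    finrank ℂ (D ⟶ m.obj) * finrank ℂ (D ⟶ m.obj)) (Finset.subset_univ {i, j})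
  rw [← h, Finset.sum_pair hij] at h2
  have := Nat.pos_of_ne_zero (mul_ne_zero hi' hi')
  have := Nat.pos_of_ne_zero (mul_ne_zero hj' hj')
  omega

variable [MonoidalPreadditive C] [MonoidalLinear ℂ C]

/-- The dual of a simple object has only scalar endomorphisms. -/
theorem finrank_end_dual (Y Y' : C) [ExactPairing Y Y'] [Simple Y] :
    finrank ℂ (Y' ⟶ Y') = 1 := by
  rw [finrank_hom_congr (Iso.refl Y') (λ_ Y').symm, ← finrank_tensorRight_hom Y' Y Y' (𝟙_ C),
    finrank_tensorLeft_hom Y Y Y', finrank_hom_congr (Iso.refl Y) (ρ_ Y)]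
  exact finrank_endomorphism_simple_eq_one ℂ Y

/-- Two simple objects with a nonzero pairing to a third one are isomorphic: each of them is
dual to it. -/
theorem eq_of_finrank_tensor_hom_unit_ne_zero {Y Y' : C} [ExactPairing Y Y'] [Simple Y]
    {i j : Label C} (hi : finrank ℂ (i.obj ⊗ Y ⟶ 𝟙_ C) ≠ 0)
    (hj : finrank ℂ (j.obj ⊗ Y ⟶ 𝟙_ C) ≠ 0) : i = j := by
  rw [finrank_tensorRight_hom _ Y Y', finrank_hom_congr (Iso.refl _) (λ_ Y')] at hi hj
  exact eq_of_finrank_hom_ne_zero (finrank_end_dual Y Y') hi hj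

end Decomposition

/-! ### The Hopf link invariant and quantum dimensions -/

section UnitScalar

variable {C : Type u} [Category.{v} C] [Abelian C] [Linear ℂ C] [MonoidalCategory C]
  [IsFusion C]

theorem unitScalar_smul_id (f : 𝟙_ C ⟶ 𝟙_ C) : unitScalar f • 𝟙 (𝟙_ C) = f :=
  (exists_unitScalar f).choose_spec

theorem unitScalar_eq_iff {f : 𝟙_ C ⟶ 𝟙_ C} {c : ℂ} : unitScalar f = c ↔ f = c • 𝟙 (𝟙_ C) := by
  constructor
  · rintro rfl
    exact (unitScalar_smul_id f).symm
  · intro h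
    refine smul_left_injective ℂ (id_nonzero (𝟙_ C)) ?_
    simpa only [unitScalar_smul_id] using h

theorem unitScalar_smul (c : ℂ) (f : 𝟙_ C ⟶ 𝟙_ C) : unitScalar (c • f) = c * unitScalar f := by
  rw [unitScalar_eq_iff, mul_smul, unitScalar_smul_id]

theorem unitScalar_sum {ι : Type*} (s : Finset ι) (f : ι → (𝟙_ C ⟶ 𝟙_ C)) :
    unitScalar (∑ k ∈ s, f k) = ∑ k ∈ s, unitScalar (f k) := by
  rw [unitScalar_eq_iff, Finset.sum_smul]
  exact Finset.sum_congr rfl fun k _ => (unitScalar_smul_id _).symm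

theorem exists_eq_smul_id {Z : C} [Simple Z] (f : Z ⟶ Z) : ∃ c : ℂ, f = c • 𝟙 Z := by
  obtain ⟨c, hc⟩ := endomorphism_simple_eq_smul_id ℂ f
  exact ⟨c, hc.symm⟩

end UnitScalar

section Hopf

open ExactPairing BraidedCategory

variable {C : Type u} [Category.{v} C] [Abelian C] [MonoidalCategory C] [BraidedCategory C]

theorem ribbonTrace_sum [MonoidalPreadditive C] [RigidCategory C] [RibbonCategory C] {X : C}
    {ι : Type*} (s : Finset ι) (f : ι → (X ⟶ X)) :
    ribbonTrace (∑ k ∈ s, f k) = ∑ k ∈ s, ribbonTrace (f k) := by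
  simp only [ribbonTrace, Preadditive.sum_comp, Preadditive.comp_sum, sum_whiskerRight]

variable [Linear ℂ C]

theorem doubleBraiding_swap_eq_smul {X Y : C} {c : ℂ} (h : doubleBraiding X Y = c • 𝟙 _) :
    doubleBraiding Y X = c • 𝟙 _ := by
  rw [← cancel_epi (β_ X Y).hom]
  have : (β_ X Y).hom ≫ doubleBraiding Y X = doubleBraiding X Y ≫ (β_ X Y).hom := by
    simp [doubleBraiding]
  rw [this, h]
  simp

theorem doubleBraiding_eq_smul_of_iso {X X₁ Y Y₁ : C} (e : X ≅ X₁) (f : Y ≅ Y₁) {c : ℂ}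
    (h : doubleBraiding X Y = c • 𝟙 _) : doubleBraiding X₁ Y₁ = c • 𝟙 _ := by
  have := doubleBraiding_naturality e.hom f.hom
  rw [← cancel_epi (e.hom ⊗ₘ f.hom), this, h]
  simp

section

variable [RigidCategory C] [RibbonCategory C] [IsFusion C]

/-- The invariant of the Hopf link coloured by two objects. -/
def hopfLink (X Y : C) : ℂ :=
  unitScalar (ribbonTrace (doubleBraiding X Y))

/-- The quantum dimension of an object. -/
def qdim (X : C) : ℂ :=
  unitScalar (ribbonTrace (𝟙 X))

theorem sMatrix_apply (i j : Label C) : sMatrix C i j = hopfLink i.obj j.obj :=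
  rfl

theorem hopfLink_comm (X Y : C) : hopfLink X Y = hopfLink Y X := by
  rw [hopfLink, ribbonTrace_doubleBraiding_comm, hopfLink]

theorem qdim_congr {X Y : C} (e : X ≅ Y) : qdim X = qdim Y := by
  rw [qdim, qdim, ← ribbonTrace_conj e]
  simp

theorem hopfLink_congr_right (Z : C) {X Y : C} (e : X ≅ Y) : hopfLink Z X = hopfLink Z Y := by
  have h := doubleBraiding_naturality (𝟙 Z) e.hom
  rw [hopfLink, hopfLink, ← ribbonTrace_conj (whiskerLeftIso Z e)]
  congr 2
  simp only [id_tensorHom] at h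
  rw [whiskerLeftIso_hom, reassoc_of% h]
  simp

theorem qdim_unit : qdim (𝟙_ C) = 1 := by
  rw [qdim, ribbonTrace_id_unit, unitScalar_eq_iff, one_smul]

theorem qdim_rightDual (X : C) : qdim Xᘁ = qdim X := by
  rw [qdim, ribbonTrace_id_rightDual, qdim]

theorem hopfLink_unit_left (X : C) : hopfLink (𝟙_ C) X = qdim X := by
  rw [hopfLink, doubleBraiding_unit_left]
  exact qdim_congr (λ_ X)

/-- The double braiding is natural, hence block diagonal with respect to a direct sum
decomposition. -/
theorem isAdditiveInvariant_hopfLink [MonoidalPreadditive C] (Z : C) :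
    IsAdditiveInvariant fun X : C => hopfLink Z X where
  congr e := hopfLink_congr_right Z e
  map_sum {n S} b hb := by
    have h1 : doubleBraiding Z b.pt =
        ∑ k, (doubleBraiding Z b.pt ≫ Z ◁ b.π k) ≫ Z ◁ b.ι k := by
      simp only [Category.assoc, ← whiskerLeft_comp]
      rw [← Preadditive.comp_sum, ← whiskerLeft_sum, hb]
      simp
    rw [hopfLink, h1, ribbonTrace_sum, unitScalar_sum]
    refine Finset.sum_congr rfl fun k _ => ?_
    have h2 := doubleBraiding_naturality (𝟙 Z) (b.ι k)
    simp only [id_tensorHom] at h2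
    rw [ribbonTrace_comp_comm, reassoc_of% h2, ← whiskerLeft_comp, Limits.bicone_ι_π_self]
    simp [hopfLink]

theorem isAdditiveInvariant_qdim [MonoidalPreadditive C] :
    IsAdditiveInvariant fun X : C => qdim X := by
  simpa only [hopfLink_unit_left] using isAdditiveInvariant_hopfLink (𝟙_ C)

end

variable [MonoidalPreadditive C] [MonoidalLinear ℂ C]

theorem doubleBraiding_tensor_right_eq_smul {X Y Z : C} {a b : ℂ}
    (hY : doubleBraiding X Y = a • 𝟙 _) (hZ : doubleBraiding X Z = b • 𝟙 _) :
    doubleBraiding X (Y ⊗ Z) = (a * b) • 𝟙 _ := by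
  have : (β_ X Y).hom ▷ Z ≫ (β_ Y X).hom ▷ Z = doubleBraiding X Y ▷ Z := by
    simp [doubleBraiding]
  rw [doubleBraiding_tensor_right, hZ]
  simp only [MonoidalLinear.whiskerLeft_smul, Linear.smul_comp, Linear.comp_smul,
    whiskerLeft_id, Category.id_comp, Iso.hom_inv_id_assoc]
  rw [reassoc_of% this, hY]
  simp [smul_smul, mul_comm]

variable [RigidCategory C] [RibbonCategory C]

theorem ribbonTrace_smul {X : C} (c : ℂ) (f : X ⟶ X) : ribbonTrace (c • f) = c • ribbonTrace f := by
  simp [ribbonTrace]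

theorem partialTrace_smul (X X' : C) [ExactPairing X X'] {Y Z : C} (c : ℂ) (h : Y ⊗ X ⟶ Z ⊗ X) :
    partialTrace X X' (c • h) = c • partialTrace X X' h := by
  simp [partialTrace]

variable [IsFusion C]

/-- A simple object `Z` defines, up to normalization, a character of the Grothendieck ring: a loop
around a strand coloured by `Z` acts as a scalar by Schur's lemma, so two parallel loops can be
removed one after the other. -/
theorem hopfLink_tensor (Z X Y : C) [Simple Z] :
    hopfLink Z (X ⊗ Y) * qdim Z = hopfLink Z X * hopfLink Z Y := by
  obtain ⟨a, ha⟩ := exists_eq_smul_id (encircle X Z)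
  obtain ⟨b, hb⟩ := exists_eq_smul_id (encircle Y Z)
  have hX : hopfLink Z X = a * qdim Z := by
    rw [hopfLink, ← ribbonTrace_encircle, ha, ribbonTrace_smul, unitScalar_smul, qdim]
  have hY : hopfLink Z Y = b * qdim Z := by
    rw [hopfLink, ← ribbonTrace_encircle, hb, ribbonTrace_smul, unitScalar_smul, qdim]
  have hXY : hopfLink Z (X ⊗ Y) = b * hopfLink Z X := by
    rw [hopfLink, ← ribbonTrace_partialTrace (X ⊗ Y) (Yᘁ ⊗ Xᘁ),
      partialTrace_doubleBraiding_tensor, hb]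
    simp only [MonoidalLinear.whiskerLeft_smul, Linear.smul_comp, Linear.comp_smul,
      whiskerLeft_id, Category.id_comp]
    rw [partialTrace_smul, ribbonTrace_smul, unitScalar_smul, ribbonTrace_partialTrace]
    rfl
  rw [hXY, hX, hY]
  ring

theorem qdim_tensor (X Y : C) : qdim (X ⊗ Y) = qdim X * qdim Y := by
  simpa [hopfLink_unit_left, qdim_unit] using hopfLink_tensor (𝟙_ C) X Y

theorem hopfLink_of_doubleBraiding_eq_smul {X Y : C} {c : ℂ}
    (h : doubleBraiding X Y = c • 𝟙 _) : hopfLink X Y = c * (qdim X * qdim Y) := by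
  rw [hopfLink, h, ribbonTrace_smul, unitScalar_smul, ← qdim_tensor, qdim]

end Hopf

/-! ### Orthogonality of the columns of the `s`-matrix -/

section Modular

variable {C : Type u} [Category.{v} C] [Abelian C] [Linear ℂ C] [MonoidalCategory C]
  [MonoidalPreadditive C] [MonoidalLinear ℂ C] [BraidedCategory C] [RigidCategory C]
  [RibbonCategory C] [IsModularTensorCategory C]

theorem sMatrix_isSymm : (sMatrix C).IsSymm :=
  Matrix.IsSymm.ext fun _ _ => hopfLink_comm _ _

variable (C) in
theorem sMatrix_mulVec_injective : Function.Injective (sMatrix C).mulVec :=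
  Matrix.mulVec_injective_iff_isUnit.2 IsModularTensorCategory.isUnit_sMatrix

/-- The row of `i` in the `s`-matrix is divisible by the dimension of `i`, so non-degeneracy
excludes that the dimension vanishes. -/
theorem qdim_label_ne_zero (i : Label C) : qdim i.obj ≠ 0 := by
  intro h0
  have hrow : ∀ j, sMatrix C i j = 0 := fun j => by
    obtain ⟨a, ha⟩ := exists_eq_smul_id (encircle j.obj i.obj)
    rw [sMatrix_apply, hopfLink, ← ribbonTrace_encircle, ha, ribbonTrace_smul, unitScalar_smul]
    rw [qdim] at h0
    rw [h0, mul_zero]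
  have : Pi.single i (1 : ℂ) = 0 := sMatrix_mulVec_injective C (by
    ext j
    rw [Matrix.mulVec_zero, Matrix.mulVec_single_one]
    exact (sMatrix_isSymm.apply i j).trans (hrow j))
  simpa using congr_fun this i

variable (C) in
/-- The label of the unit object. -/
def unitLabel : Label C :=
  Label.mk (𝟙_ C) simple_unit

variable (C) in
/-- The object chosen to represent the label of the unit is isomorphic to the unit. -/
def unitLabelIso : (unitLabel C).obj ≅ 𝟙_ C :=
  (Label.nonempty_obj_iso simple_unit).some

theorem hopfLink_unitLabel (X : C) : hopfLink (unitLabel C).obj X = qdim X := by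
  rw [hopfLink_comm, hopfLink_congr_right X (unitLabelIso C),
    hopfLink_comm, hopfLink_unit_left]

/-- The sum of all simple objects, weighted by their dimensions, absorbs every object `k` up to the
factor `dim k`: by duality the multiplicity of `i` in `k* ⊗ m` is that of `m` in `k ⊗ i`, and
summing against the dimensions of the `i` gives the dimension of `k* ⊗ m`. -/
theorem hopfLink_mul_sum_qdim (l : Label C) (k : C) :
    hopfLink l.obj k * ∑ i : Label C, qdim i.obj * hopfLink l.obj i.obj =
      qdim l.obj * qdim k * ∑ i : Label C, qdim i.obj * hopfLink l.obj i.obj := by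
  -- The braiding makes the right dual of `k` a left dual as well, as the adjunction below requires.
  let _ : ExactPairing kᘁ k := BraidedCategory.exactPairing_swap k kᘁ
  have h1 : ∀ i : Label C, hopfLink l.obj k * (qdim i.obj * hopfLink l.obj i.obj) =
      ∑ m : Label C, qdim l.obj * hopfLink l.obj m.obj *
        ((Module.finrank ℂ (kᘁ ⊗ m.obj ⟶ i.obj) : ℂ) * qdim i.obj) := fun i => by
    rw [mul_left_comm, ← hopfLink_tensor, (isAdditiveInvariant_hopfLink _).eq_sum (k ⊗ i.obj),
      Finset.sum_mul, Finset.mul_sum]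
    refine Finset.sum_congr rfl fun m _ => ?_
    rw [finrank_tensorLeft_hom i.obj kᘁ k, ← finrank_hom_from_label]
    ring
  rw [Finset.mul_sum, Finset.sum_congr rfl fun i _ => h1 i, Finset.sum_comm, Finset.mul_sum]
  refine Finset.sum_congr rfl fun m _ => ?_
  rw [← Finset.mul_sum, ← isAdditiveInvariant_qdim.eq_sum (kᘁ ⊗ m.obj), qdim_tensor,
    qdim_rightDual]
  ring

/-- If the sum did not vanish, the row of `l` would be a multiple of the row of the unit. -/
theorem sum_qdim_mul_hopfLink_eq_zero {l : Label C} (hl : l ≠ unitLabel C) :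
    ∑ i : Label C, qdim i.obj * hopfLink l.obj i.obj = 0 := by
  by_contra hF
  have hrow : ∀ j : Label C, sMatrix C l j = qdim l.obj * sMatrix C (unitLabel C) j := fun j => by
    rw [sMatrix_apply, sMatrix_apply, hopfLink_unitLabel]
    exact mul_right_cancel₀ hF (hopfLink_mul_sum_qdim l j.obj)
  have h : (sMatrix C).mulVec (Pi.single l (1 : ℂ) - Pi.single (unitLabel C) (qdim l.obj)) =
      (sMatrix C).mulVec 0 := by
    ext j
    rw [Matrix.mulVec_zero, Matrix.mulVec_sub, Matrix.mulVec_single_one, Matrix.mulVec_single]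
    simp only [Pi.sub_apply, Pi.zero_apply, Pi.smul_apply, Matrix.col_apply,
      MulOpposite.smul_eq_mul_unop, MulOpposite.unop_op, sub_eq_zero]
    rw [sMatrix_isSymm.apply l j, sMatrix_isSymm.apply (unitLabel C) j, hrow, mul_comm]
  have := sMatrix_mulVec_injective C h
  simpa [hl] using congr_fun this l

/-- Two columns of the `s`-matrix are orthogonal (for the bilinear form) unless their labels are
dual to each other. -/
theorem sum_sMatrix_mul_sMatrix_eq_zero {j k : Label C}
    (hjk : Module.finrank ℂ (j.obj ⊗ k.obj ⟶ 𝟙_ C) = 0) :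
    ∑ i, sMatrix C i j * sMatrix C i k = 0 := by
  have h1 : ∀ i : Label C, sMatrix C i j * sMatrix C i k =
      ∑ m : Label C, (Module.finrank ℂ (j.obj ⊗ k.obj ⟶ m.obj) : ℂ) *
        (qdim i.obj * hopfLink m.obj i.obj) := fun i => by
    rw [sMatrix_apply, sMatrix_apply, ← hopfLink_tensor,
      (isAdditiveInvariant_hopfLink _).eq_sum (j.obj ⊗ k.obj), Finset.sum_mul]
    refine Finset.sum_congr rfl fun m _ => ?_
    rw [hopfLink_comm]
    ring
  rw [Finset.sum_congr rfl fun i _ => h1 i, Finset.sum_comm]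
  refine Finset.sum_eq_zero fun m _ => ?_
  rw [← Finset.mul_sum]
  by_cases hm : m = unitLabel C
  · rw [hm, finrank_hom_congr (Iso.refl _) (unitLabelIso C), hjk,
      Nat.cast_zero, zero_mul]
  · rw [sum_qdim_mul_hopfLink_eq_zero hm, mul_zero]

end Modular

/-! ### Symmetric matrices with a graded involution -/

section LinearAlgebra

open Matrix

/-- A non-degenerate symmetric matrix `S` whose index set carries an involution `bar` and a grading
`ζ` with values `±1`, such that passing from a row `i` to the row `bar i` multiplies the entries by
a sign, which depends only on the degree of the column. The fixed points of the involution have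
degree `-1`. -/
structure IsGradedInvolution {L : Type*} [Fintype L] (S : Matrix L L ℂ) (bar : L → L) (ζ : L → ℂ)
    (d : ℂ) : Prop where
  isSymm : S.IsSymm
  injective : Function.Injective S.mulVec
  bar_bar : ∀ i, bar (bar i) = i
  zeta_eq : ∀ i, ζ i = 1 ∨ ζ i = -1
  sign_sq : d * d = 1
  bar_apply : ∀ i j, S (bar i) j = d * ζ j * S i j
  zeta_fixed : ∀ i, bar i = i → ζ i = -1
  sign_fixed : ∀ i, bar i = i → d = 1

/-- `T` consists of one element of each two-element orbit of degree `z`. The condition `bar_ne` says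
both that the elements of `T` are not fixed and that distinct elements lie in distinct orbits. -/
structure IsOrbitSection {L : Type*} (bar : L → L) (ζ : L → ℂ) (z : ℂ) (T : Finset L) : Prop where
  zeta_eq : ∀ i ∈ T, ζ i = z
  bar_ne : ∀ i ∈ T, ∀ j ∈ T, bar j ≠ i
  exists_mem : ∀ i, ζ i = z → bar i ≠ i → i ∈ T ∨ ∃ t ∈ T, i = bar t

variable {L : Type*} {S : Matrix L L ℂ} {bar : L → L} {ζ : L → ℂ}
  {d : ℂ}

theorem IsOrbitSection.eq_zero_of_mem {z : ℂ} {T : Finset L} (hT : IsOrbitSection bar ζ z T)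
    {g : L → ℂ} {c : ℂ} (hg : ∀ i, g (bar i) = c * g i) (h0 : ∀ i ∈ T, g i = 0) {i : L}
    (hi : ζ i = z) (hb : bar i ≠ i) : g i = 0 := by
  rcases hT.exists_mem i hi hb with h | ⟨t, ht, rfl⟩
  · exact h0 i h
  · rw [hg, h0 t ht, mul_zero]

section

variable [Fintype L]

theorem IsOrbitSection.sum_bar_apply_mul {z : ℂ} {T : Finset L} (hT : IsOrbitSection bar ζ z T)
    (h : IsGradedInvolution S bar ζ d) (x : T → ℂ) (i : L) :
    ∑ j : T, S (bar i) j * x j = d * z * ∑ j : T, S i j * x j := by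
  rw [Finset.mul_sum]
  refine Finset.sum_congr rfl fun j _ => ?_
  rw [h.bar_apply, hT.zeta_eq j j.2, mul_assoc]

theorem IsGradedInvolution.apply_bar (h : IsGradedInvolution S bar ζ d) (i j : L) :
    S i (bar j) = d * ζ i * S i j := by
  rw [← h.isSymm.apply, h.bar_apply, h.isSymm.apply]

/-- An entry with both labels of degree `-1`, one of them fixed, vanishes. -/
theorem IsGradedInvolution.apply_fixed (h : IsGradedInvolution S bar ζ d) {i k : L}
    (hi : ζ i = -1) (hk : bar k = k) : S i k = 0 := by
  have := h.apply_bar i k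
  rw [hk, hi, h.sign_fixed k hk] at this
  linear_combination this / 2

end

variable [DecidableEq L]

/-- The vector that extends `x` from a set `T` of orbit representatives to the orbits, with the
factor `ε` on the second element of each orbit. -/
def orbitExtend (bar : L → L) (T : Finset L) (ε : ℂ) (x : T → ℂ) : L → ℂ :=
  ∑ j : T, x j • (Pi.single (j : L) 1 + ε • Pi.single (bar j) 1)

theorem orbitExtend_apply_mem {z : ℂ} {T : Finset L} (hT : IsOrbitSection bar ζ z T) (ε : ℂ)
    (x : T → ℂ) (i : T) : orbitExtend bar T ε x i = x i := by
  have : ∀ j : T, Pi.single (M := fun _ => ℂ) (bar j) (1 : ℂ) (i : L) = 0 := fun j =>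
    Pi.single_eq_of_ne (hT.bar_ne i i.2 j j.2).symm _
  simp [orbitExtend, Finset.sum_apply, this, Pi.single_apply]

theorem orbitExtend_apply_fixed {z : ℂ} {T : Finset L} (hT : IsOrbitSection bar ζ z T)
    (hbar : ∀ i, bar (bar i) = i) (ε : ℂ) (x : T → ℂ) {i : L} (hi : bar i = i) :
    orbitExtend bar T ε x i = 0 := by
  have h1 : ∀ j : T, i ≠ j := fun j h => hT.bar_ne j j.2 j j.2 (h ▸ hi)
  have h2 : ∀ j : T, i ≠ bar j := fun j h => h1 j (by rw [← hi, h, hbar])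
  simp [orbitExtend, Finset.sum_apply, h1, h2]

variable [Fintype L]

theorem IsGradedInvolution.mulVec_orbitExtend (h : IsGradedInvolution S bar ζ d) (T : Finset L)
    (ε : ℂ) (x : T → ℂ) (i : L) :
    (S *ᵥ orbitExtend bar T ε x) i = (1 + ε * (d * ζ i)) * ∑ j : T, S i j * x j := by
  rw [orbitExtend, mulVec_sum, Finset.sum_apply, Finset.mul_sum]
  refine Finset.sum_congr rfl fun j _ => ?_
  simp only [mulVec_smul, mulVec_add, mulVec_single_one, Pi.smul_apply, Pi.add_apply,
    col_apply, smul_eq_mul, h.apply_bar]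
  ring

variable {N R F : Finset L}

/-- A vector in the kernel of the block of even orbits extends to the kernel of `S`, with factor
`d` on the second elements of the orbits: the rows of degree `-1` then vanish identically. -/
theorem IsGradedInvolution.injective_even (h : IsGradedInvolution S bar ζ d)
    (hN : IsOrbitSection bar ζ 1 N) :
    Function.Injective (S.submatrix (fun i : N => (i : L)) (fun i : N => (i : L))).mulVec := by
  refine (injective_iff_map_eq_zero (mulVecLin _)).2 fun x hx => ?_
  have hx' : ∀ i ∈ N, ∑ j : N, S i j * x j = 0 := fun i hi => congr_fun hx ⟨i, hi⟩
  have h0 : S *ᵥ orbitExtend bar N d x = S *ᵥ 0 := by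
    ext i
    rw [h.mulVec_orbitExtend, mulVec_zero, Pi.zero_apply]
    rcases h.zeta_eq i with hi | hi
    · rw [hN.eq_zero_of_mem (hN.sum_bar_apply_mul h x) hx' hi, mul_zero]
      intro hb
      have := h.zeta_fixed i hb
      rw [hi] at this
      norm_num at this
    · rw [hi]
      linear_combination (-∑ j : N, S i j * x j) * h.sign_sq
  ext i
  rw [← orbitExtend_apply_mem hN d x i, h.injective h0]
  rfl

/-- A vector in the kernel of the block of odd orbits extends to the kernel of `S`, with factor
`-d` on the second elements of the orbits: the rows of degree `1` then vanish identically. -/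
theorem IsGradedInvolution.injective_odd (h : IsGradedInvolution S bar ζ d)
    (hR : IsOrbitSection bar ζ (-1) R) :
    Function.Injective (S.submatrix (fun i : R => (i : L)) (fun i : R => (i : L))).mulVec := by
  refine (injective_iff_map_eq_zero (mulVecLin _)).2 fun x hx => ?_
  have hx' : ∀ i ∈ R, ∑ j : R, S i j * x j = 0 := fun i hi => congr_fun hx ⟨i, hi⟩
  have h0 : S *ᵥ orbitExtend bar R (-d) x = S *ᵥ 0 := by
    ext i
    rw [h.mulVec_orbitExtend, mulVec_zero, Pi.zero_apply]
    rcases h.zeta_eq i with hi | hi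
    · rw [hi]
      linear_combination (-∑ j : R, S i j * x j) * h.sign_sq
    · by_cases hb : bar i = i
      · rw [Finset.sum_eq_zero, mul_zero]
        intro j _
        rw [← h.isSymm.apply, h.apply_fixed (hR.zeta_eq j j.2) hb, zero_mul]
      · rw [hR.eq_zero_of_mem (hR.sum_bar_apply_mul h x) hx' hi hb, mul_zero]
  ext i
  rw [← orbitExtend_apply_mem hR (-d) x i, h.injective h0]
  rfl

/-- A vector in the kernel extends to the kernel of `S`, with factor `d` on the second elements of
the odd orbits. Each odd orbit then counts twice in the even rows, whence the factor `2` on the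
fixed points. -/
theorem IsGradedInvolution.injective_mixed (h : IsGradedInvolution S bar ζ d)
    (hN : IsOrbitSection bar ζ 1 N) (hR : IsOrbitSection bar ζ (-1) R)
    (hF : ∀ i, i ∈ F ↔ bar i = i) :
    Function.Injective (fromCols (S.submatrix (fun i : N => (i : L)) (fun j : R => (j : L)))
      (S.submatrix (fun i : N => (i : L)) (fun j : F => (j : L)))).mulVec := by
  refine (injective_iff_map_eq_zero (mulVecLin _)).2 fun w hw => ?_
  set x : R → ℂ := fun j => w (Sum.inl j) with hxdef
  set y : F → ℂ := fun j => w (Sum.inr j) with hydef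
  have hw' : ∀ i ∈ N, ∑ j : R, S i j * x j + ∑ j : F, S i j * y j = 0 := fun i hi => by
    have := congr_fun hw ⟨i, hi⟩
    simpa [mulVec, dotProduct, Fintype.sum_sum_type] using this
  let f : L → ℂ := ∑ j : F, y j • Pi.single (j : L) 1
  have hf : ∀ i, (S *ᵥ f) i = ∑ j : F, S i j * y j := fun i => by
    simp only [f, mulVec_sum, Finset.sum_apply, mulVec_smul, mulVec_single_one, Pi.smul_apply,
      col_apply, smul_eq_mul, mul_comm]
  have hg : ∀ i, (∑ j : R, S (bar i) j * x j + ∑ j : F, S (bar i) j * y j) =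
      d * (-1) * (∑ j : R, S i j * x j + ∑ j : F, S i j * y j) := fun i => by
    rw [mul_add, hR.sum_bar_apply_mul h, Finset.mul_sum Finset.univ (fun j : F => S i j * y j)]
    congr 1
    refine Finset.sum_congr rfl fun j _ => ?_
    rw [h.bar_apply, h.zeta_fixed j ((hF j).1 j.2), mul_assoc]
  have h0 : S *ᵥ (orbitExtend bar R d x + (2 : ℂ) • f) = S *ᵥ 0 := by
    ext i
    rw [mulVec_add, mulVec_smul, Pi.add_apply, Pi.smul_apply, h.mulVec_orbitExtend, mulVec_zero,
      Pi.zero_apply, hf, smul_eq_mul]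
    rcases h.zeta_eq i with hi | hi
    · have hb : bar i ≠ i := fun hb => by
        have := h.zeta_fixed i hb
        rw [hi] at this
        norm_num at this
      have := hN.eq_zero_of_mem hg hw' hi hb
      rw [hi]
      linear_combination 2 * this + (∑ j : R, S i j * x j) * h.sign_sq
    · have : ∑ j : F, S i j * y j = 0 := Finset.sum_eq_zero fun j _ => by
        rw [h.apply_fixed hi ((hF j).1 j.2), zero_mul]
      rw [hi, this]
      linear_combination (-∑ j : R, S i j * x j) * h.sign_sq
  have h1 := congr_fun (h.injective h0)
  simp only [Pi.add_apply, Pi.smul_apply, Pi.zero_apply, smul_eq_mul] at h1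
  ext (j | j)
  · have h2 := h1 j
    have h3 : f j = 0 := by
      have : ∀ k : F, (j : L) ≠ k := fun k e =>
        hR.bar_ne j j.2 j j.2 (by rw [e]; exact (hF k).1 k.2)
      simp [f, Finset.sum_apply, this]
    rw [orbitExtend_apply_mem hR, h3, mul_zero, add_zero] at h2
    exact h2
  · have h2 := h1 j
    have h3 : f j = y j := by
      simp [f, Finset.sum_apply, Pi.single_apply]
    rw [orbitExtend_apply_fixed hR h.bar_bar d x ((hF j).1 j.2), h3, zero_add]
      at h2
    exact (mul_eq_zero.1 h2).resolve_left two_ne_zero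

/-- A vector in the kernel of the transpose extends to the kernel of `S`, with factor `-d` on the
second elements of the even orbits: the rows of degree `1` then vanish identically. -/
theorem IsGradedInvolution.injective_mixed_transpose (h : IsGradedInvolution S bar ζ d)
    (hN : IsOrbitSection bar ζ 1 N) (hR : IsOrbitSection bar ζ (-1) R)
    (hF : ∀ i, i ∈ F ↔ bar i = i) :
    Function.Injective (fromCols (S.submatrix (fun i : N => (i : L)) (fun j : R => (j : L)))
      (S.submatrix (fun i : N => (i : L)) (fun j : F => (j : L))))ᵀ.mulVec := by
  refine (injective_iff_map_eq_zero (mulVecLin _)).2 fun x hx => ?_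
  have hxR : ∀ i ∈ R, ∑ j : N, S i j * x j = 0 := fun i hi => by
    refine (Finset.sum_congr rfl fun j _ => ?_).trans (congr_fun hx (Sum.inl ⟨i, hi⟩))
    rw [← h.isSymm.apply]
    rfl
  have hxF : ∀ i ∈ F, ∑ j : N, S i j * x j = 0 := fun i hi => by
    refine (Finset.sum_congr rfl fun j _ => ?_).trans (congr_fun hx (Sum.inr ⟨i, hi⟩))
    rw [← h.isSymm.apply]
    rfl
  have h0 : S *ᵥ orbitExtend bar N (-d) x = S *ᵥ 0 := by
    ext i
    rw [h.mulVec_orbitExtend, mulVec_zero, Pi.zero_apply]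
    rcases h.zeta_eq i with hi | hi
    · rw [hi]
      linear_combination (-∑ j : N, S i j * x j) * h.sign_sq
    · by_cases hb : bar i = i
      · rw [hxF i ((hF i).2 hb), mul_zero]
      · rw [hR.eq_zero_of_mem (hN.sum_bar_apply_mul h x) hxR hi hb, mul_zero]
  ext i
  rw [← orbitExtend_apply_mem hN (-d) x i, h.injective h0]
  rfl

theorem exists_left_inverse_of_mulVec_injective {m n : Type*} [Fintype m] [Fintype n]
    [DecidableEq m] [DecidableEq n] {M : Matrix m n ℂ} (h : Function.Injective M.mulVec) :
    ∃ A : Matrix n m ℂ, A * M = 1 := by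
  obtain ⟨g, hg⟩ := M.mulVecLin.exists_leftInverse_of_injective (LinearMap.ker_eq_bot.2 h)
  refine ⟨LinearMap.toMatrix' g, ?_⟩
  apply Matrix.toLin'.injective
  rw [toLin'_mul, toLin'_toMatrix', toLin'_one]
  exact hg

theorem nonSingular_of_injective {m n : Type*} [Fintype m] [Fintype n] [DecidableEq m]
    [DecidableEq n] {M : Matrix m n ℂ} (h1 : Function.Injective M.mulVec)
    (h2 : Function.Injective Mᵀ.mulVec) : NonSingular M := by
  obtain ⟨A, hA⟩ := exists_left_inverse_of_mulVec_injective h1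
  obtain ⟨B, hB⟩ := exists_left_inverse_of_mulVec_injective h2
  have hB' : M * Bᵀ = 1 := by
    rw [← transpose_transpose M, ← transpose_mul, hB, transpose_one]
  refine ⟨A, ?_, hA⟩
  rw [← hB', ← Matrix.one_mul Bᵀ, ← hA, Matrix.mul_assoc A, hB', Matrix.mul_one]

/-- The sum of a `bar`-invariant function supported in degree `1` is twice its sum over orbit
representatives. -/
theorem IsGradedInvolution.sum_eq_two_mul (h : IsGradedInvolution S bar ζ d)
    (hN : IsOrbitSection bar ζ 1 N) {f : L → ℂ} (hf : ∀ i, f (bar i) = f i)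
    (h0 : ∀ i, ζ i = -1 → f i = 0) : ∑ i, f i = 2 * ∑ i ∈ N, f i := by
  have hinj : Function.Injective bar := Function.Involutive.injective h.bar_bar
  have hdisj : Disjoint N (N.image bar) := by
    refine Finset.disjoint_left.2 fun i hi hi' => ?_
    obtain ⟨j, hj, hji⟩ := Finset.mem_image.1 hi'
    exact hN.bar_ne i hi j hj hji
  rw [← Finset.sum_subset (Finset.subset_univ (N ∪ N.image bar)), Finset.sum_union hdisj,
    Finset.sum_image hinj.injOn, two_mul]
  · simp only [hf]
  · intro i _ hi
    rcases h.zeta_eq i with hz | hz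
    · refine absurd ?_ hi
      have hb : bar i ≠ i := fun hb => by
        have := h.zeta_fixed i hb
        rw [hz] at this
        norm_num at this
      rcases hN.exists_mem i hz hb with hm | ⟨t, ht, rfl⟩
      · exact Finset.mem_union_left _ hm
      · exact Finset.mem_union_right _ (Finset.mem_image_of_mem _ ht)
    · exact h0 i hz

end LinearAlgebra

/-! ### Pre-Clifford categories -/

theorem smul_id_injective {C : Type u} [Category.{v} C] [Abelian C] [Linear ℂ C] {X : C}
    (hX : Simple X) : Function.Injective fun c : ℂ => c • 𝟙 X :=
  smul_left_injective ℂ (id_nonzero X)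

namespace PreClifford

section Bar

variable {C : Type u} [Category.{v} C] [Abelian C] [MonoidalCategory C]
  [BraidedCategory C] [RigidCategory C] [RibbonCategory C] (P : PreClifford C)

theorem nonempty_bar_obj_iso (i : Label C) : Nonempty ((P.bar i).obj ≅ P.V ⊗ i.obj) :=
  Label.nonempty_obj_iso _

theorem bar_bar (i : Label C) : P.bar (P.bar i) = i := by
  obtain ⟨e⟩ := P.nonempty_bar_obj_iso i
  obtain ⟨f⟩ := P.nonempty_bar_obj_iso (P.bar i)
  exact Label.obj_iso_iff.1 ⟨f ≪≫ whiskerLeftIso P.V e ≪≫ (P.tensorTwice.app i.obj).symm⟩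

end Bar

variable {C : Type u} [Category.{v} C] [Abelian C] [Linear ℂ C] [MonoidalCategory C]
  [BraidedCategory C] [RigidCategory C] [RibbonCategory C]

theorem exists_zeta_eq_smul [IsFusion C] (P : PreClifford C) (i : Label C) :
    ∃ c : ℂ, doubleBraiding P.V i.obj = c • 𝟙 _ :=
  have := P.simple_tensor i.obj i.simple_obj
  exists_eq_smul_id _

/-- The scalar by which the double braiding of `V` with a simple object acts. -/
def zetaScalar [IsFusion C] (P : PreClifford C) (i : Label C) : ℂ :=
  (P.exists_zeta_eq_smul i).choose

theorem doubleBraiding_V [IsFusion C] (P : PreClifford C) (i : Label C) :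
    doubleBraiding P.V i.obj = P.zetaScalar i • 𝟙 _ :=
  (P.exists_zeta_eq_smul i).choose_spec

theorem zetaScalar_eq_iff [IsFusion C] (P : PreClifford C) (i : Label C) (c : ℂ) :
    P.zetaScalar i = c ↔ P.zeta i.obj = c • 𝟙 _ := by
  rw [zeta, doubleBraiding_V]
  exact (smul_id_injective (P.simple_tensor i.obj i.simple_obj)).eq_iff.symm

theorem isNS_iff [IsFusion C] (P : PreClifford C) (i : Label C) :
    P.IsNS i ↔ P.zetaScalar i = 1 := by
  rw [zetaScalar_eq_iff, one_smul, IsNS]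

theorem isR_iff [IsFusion C] (P : PreClifford C) (i : Label C) :
    P.IsR i ↔ P.zetaScalar i = -1 := by
  rw [zetaScalar_eq_iff, neg_one_smul, IsR]

theorem IsRepresentatives.isOrbitSection [IsFusion C] {P : PreClifford C} {type : Label C → Prop}
    {T : Finset (Label C)} (hT : P.IsRepresentatives type T) {z : ℂ}
    (hz : ∀ i, type i ↔ P.zetaScalar i = z) : IsOrbitSection P.bar P.zetaScalar z T where
  zeta_eq i hi := (hz i).1 (hT.1 i hi).1
  bar_ne i hi j hj hji := by
    obtain ⟨hj1, hj2⟩ := hT.1 j hj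
    have := (hT.2 j hj1 hj2).unique ⟨hi, Or.inr hji.symm⟩ ⟨hj, Or.inl rfl⟩
    exact hj2 (hji.trans this)
  exists_mem i hi hb := by
    obtain ⟨t, ⟨ht, rfl | rfl⟩, -⟩ := hT.2 i ((hz i).2 hi) hb
    · exact Or.inl ht
    · exact Or.inr ⟨_, ht, (P.bar_bar i).symm⟩

/-- If `V ⊗ X ≅ X` for a simple object `X`, comparing the twists of both sides shows that `X` is
a Ramond object. -/
theorem zetaScalar_of_bar_eq [MonoidalPreadditive C] [MonoidalLinear ℂ C] [IsFusion C]
    (P : PreClifford C) {i : Label C} (hi : P.bar i = i) : P.zetaScalar i = -1 := by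
  obtain ⟨e⟩ := P.nonempty_bar_obj_iso i
  rw [hi] at e
  obtain ⟨t, ht⟩ := exists_eq_smul_id (twist i.obj).hom
  have ht0 : t ≠ 0 := by
    rintro rfl
    rw [zero_smul] at ht
    have := (twist i.obj).hom_inv_id
    rw [ht, Limits.zero_comp] at this
    exact id_nonzero i.obj this.symm
  have h1 : (twist (P.V ⊗ i.obj)).hom = (-(t * P.zetaScalar i)) • 𝟙 _ := by
    have := RibbonCategory.twist_tensor P.V i.obj
    change _ = _ ≫ doubleBraiding P.V i.obj at this
    rw [twist, this, doubleBraiding_V]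
    change ((twist P.V).hom ⊗ₘ (twist i.obj).hom) ≫ _ = _
    have hV : (twist P.V).hom = (-1 : ℂ) • 𝟙 P.V := by rw [P.twist_V, neg_one_smul]
    rw [hV, ht, MonoidalCategory.tensorHom_def]
    simp only [MonoidalLinear.smul_whiskerRight, MonoidalLinear.whiskerLeft_smul, id_whiskerRight,
      whiskerLeft_id, Linear.comp_smul, Category.comp_id, smul_smul]
    congr 1
    ring
  have h2 : e.hom ≫ (twist (P.V ⊗ i.obj)).hom = (twist i.obj).hom ≫ e.hom :=
    RibbonCategory.twist_naturality e.hom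
  have h3 : (-(t * P.zetaScalar i)) = t := by
    refine smul_id_injective i.simple_obj ?_
    rw [h1, ht] at h2
    rw [← cancel_mono e.hom]
    simpa using h2
  refine mul_left_cancel₀ ht0 ?_
  linear_combination -h3

variable [MonoidalPreadditive C] [MonoidalLinear ℂ C]

/-- As `V ⊗ V ≅ 1`, the double braiding with `V` squares to the identity. -/
theorem zetaScalar_eq [IsFusion C] (P : PreClifford C) (i : Label C) :
    P.zetaScalar i = 1 ∨ P.zetaScalar i = -1 := by
  have h1 := doubleBraiding_swap_eq_smul (P.doubleBraiding_V i)
  have h2 := doubleBraiding_eq_smul_of_iso (Iso.refl i.obj) P.ι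
    (doubleBraiding_tensor_right_eq_smul h1 h1)
  have h3 : doubleBraiding i.obj (𝟙_ C) = (1 : ℂ) • 𝟙 _ :=
    doubleBraiding_swap_eq_smul (by rw [doubleBraiding_unit_left, one_smul])
  refine mul_self_eq_one_iff.1 (smul_id_injective ?_ (h2.symm.trans h3))
  exact Simple.of_iso (ρ_ i.obj)

theorem qdim_V_mul_self [IsFusion C] (P : PreClifford C) : qdim P.V * qdim P.V = 1 := by
  rw [← qdim_tensor, qdim_congr P.ι, qdim_unit]

variable [IsModularTensorCategory C] (P : PreClifford C)

/-- A loop coloured by `V` around a simple object `j` contributes the factor `dim V * ζ_j`. -/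
theorem sMatrix_bar_apply (i j : Label C) :
    sMatrix C (P.bar i) j = qdim P.V * P.zetaScalar j * sMatrix C i j := by
  have h1 := hopfLink_of_doubleBraiding_eq_smul
    (doubleBraiding_swap_eq_smul (P.doubleBraiding_V j))
  have h2 := hopfLink_tensor j.obj P.V i.obj
  refine mul_right_cancel₀ (qdim_label_ne_zero j) ?_
  rw [sMatrix_apply, sMatrix_apply, hopfLink_comm,
    hopfLink_congr_right _ (P.nonempty_bar_obj_iso i).some, h2, h1, hopfLink_comm i.obj]
  ring

theorem zetaScalar_unitLabel : P.zetaScalar (unitLabel C) = 1 := by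
  have h : doubleBraiding P.V (𝟙_ C) = (1 : ℂ) • 𝟙 _ :=
    doubleBraiding_swap_eq_smul (by rw [doubleBraiding_unit_left, one_smul])
  exact (P.zetaScalar_eq_iff _ _).2
    (doubleBraiding_eq_smul_of_iso (Iso.refl _) (unitLabelIso C).symm h)

theorem isGradedInvolution :
    IsGradedInvolution (sMatrix C) P.bar P.zetaScalar (qdim P.V) where
  isSymm := sMatrix_isSymm
  injective := sMatrix_mulVec_injective C
  bar_bar := P.bar_bar
  zeta_eq := P.zetaScalar_eq
  sign_sq := P.qdim_V_mul_self
  bar_apply := P.sMatrix_bar_apply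
  zeta_fixed i hi := P.zetaScalar_of_bar_eq hi
  sign_fixed i hi := by
    have h := P.sMatrix_bar_apply i (unitLabel C)
    -- The column of the unit has degree `1` and nonzero entries, which determines the sign.
    have h0 : sMatrix C i (unitLabel C) ≠ 0 := by
      rw [← sMatrix_isSymm.apply, sMatrix_apply, hopfLink_unitLabel]
      exact qdim_label_ne_zero i
    rw [hi, zetaScalar_unitLabel, mul_one] at h
    exact mul_right_cancel₀ h0 (by rw [one_mul, ← h])

/-- A fixed point of the involution can only be dual to a fixed point. -/
theorem finrank_tensor_hom_unit_eq_zero {j k : Label C} (hj : P.bar j ≠ j) (hk : P.bar k = k) :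
    Module.finrank ℂ (j.obj ⊗ k.obj ⟶ 𝟙_ C) = 0 := by
  by_contra h
  obtain ⟨e⟩ := P.nonempty_bar_obj_iso j
  obtain ⟨f⟩ := P.nonempty_bar_obj_iso k
  rw [hk] at f
  have h' : Module.finrank ℂ ((P.bar j).obj ⊗ k.obj ⟶ 𝟙_ C) ≠ 0 := by
    rwa [finrank_hom_congr (whiskerRightIso (e ≪≫ β_ P.V j.obj) k.obj ≪≫ α_ j.obj P.V k.obj ≪≫
      whiskerLeftIso j.obj f.symm) (Iso.refl _)]
  exact hj (eq_of_finrank_tensor_hom_unit_ne_zero (Y' := k.objᘁ) h' h)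

theorem sum_sMatrix_mul_sMatrix_representatives {NSp : Finset (Label C)}
    (hN : IsOrbitSection P.bar P.zetaScalar 1 NSp) {j k : Label C} (hj : P.zetaScalar j = -1)
    (hbj : P.bar j ≠ j) (hk : P.bar k = k) :
    ∑ i ∈ NSp, sMatrix C i j * sMatrix C i k = 0 := by
  have h := P.isGradedInvolution
  have hsum := sum_sMatrix_mul_sMatrix_eq_zero (P.finrank_tensor_hom_unit_eq_zero hbj hk)
  rw [h.sum_eq_two_mul hN (f := fun i => sMatrix C i j * sMatrix C i k)] at hsum
  · exact (mul_eq_zero.1 hsum).resolve_left two_ne_zero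
  · intro i
    rw [h.bar_apply, h.bar_apply, hj, h.zeta_fixed k hk, h.sign_fixed k hk]
    ring
  · intro i hi
    rw [h.apply_fixed hi hk, mul_zero]

end PreClifford

end ModularTensor

end

theorem mainTheorem5 (C : Type u) [Category.{v} C] [Abelian C] [Linear ℂ C]
    [MonoidalCategory C] [MonoidalPreadditive C] [MonoidalLinear ℂ C]
    [BraidedCategory C] [RigidCategory C] [ModularTensor.RibbonCategory C]
    [ModularTensor.IsModularTensorCategory C] (P : ModularTensor.PreClifford C)
    (NSp Rp : Finset (ModularTensor.Label C))
    (hNS : P.IsRepresentatives P.IsNS NSp) (hR : P.IsRepresentatives P.IsR Rp)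
    (A : Matrix NSp NSp ℂ) (B : Matrix NSp Rp ℂ) (D : Matrix NSp P.R0 ℂ) (E : Matrix Rp Rp ℂ)
    (hA : A = ModularTensor.sBlock C NSp NSp) (hB : B = ModularTensor.sBlock C NSp Rp)
    (hD : D = ModularTensor.sBlock C NSp P.R0) (hE : E = ModularTensor.sBlock C Rp Rp) :
    (A.IsSymm ∧ ModularTensor.NonSingular A) ∧
    (E.IsSymm ∧ ModularTensor.NonSingular E) ∧
    ModularTensor.NonSingular (Matrix.fromCols B D) ∧
    B.transpose * D = 0 ∧
    Rp.card + P.R0.card = NSp.card := by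
  subst hA hB hD hE
  have h := P.isGradedInvolution
  have hN := hNS.isOrbitSection P.isNS_iff
  have hR' := hR.isOrbitSection P.isR_iff
  have hF : ∀ i, i ∈ P.R0 ↔ P.bar i = i := fun i => by simp [ModularTensor.PreClifford.R0]
  have hsymm : ∀ T : Finset (ModularTensor.Label C), (ModularTensor.sBlock C T T).IsSymm :=
    fun T => h.isSymm.submatrix _
  have hM : ModularTensor.NonSingular
      (Matrix.fromCols (ModularTensor.sBlock C NSp Rp) (ModularTensor.sBlock C NSp P.R0)) :=
    ModularTensor.nonSingular_of_injective (h.injective_mixed hN hR' hF)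
      (h.injective_mixed_transpose hN hR' hF)
  refine ⟨⟨hsymm NSp, ?_⟩, ⟨hsymm Rp, ?_⟩, hM, ?_, ?_⟩
  · refine ModularTensor.nonSingular_of_injective (h.injective_even hN) ?_
    rw [hsymm NSp]
    exact h.injective_even hN
  · refine ModularTensor.nonSingular_of_injective (h.injective_odd hR') ?_
    rw [hsymm Rp]
    exact h.injective_odd hR'
  · ext j k
    rw [Matrix.mul_apply, Matrix.zero_apply]
    exact (Finset.sum_coe_sort NSp fun i =>
      ModularTensor.sMatrix C i j * ModularTensor.sMatrix C i k).trans
      (P.sum_sMatrix_mul_sMatrix_representatives hN (hR'.zeta_eq j j.2)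
        (hR.1 j j.2).2 ((hF k).1 k.2))
  · obtain ⟨M', h1, h2⟩ := hM
    have := Matrix.square_of_invertible _ _ h1 h2
    simpa using this.symm
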